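/- Let $\mathcal M=\langle Q,\mathsf A,\delta\rangle$ be a Markov decision process with finite state set $Q$, finite action set $\mathsf A$ and transition function $\delta:Q\times\mathsf A\to\mathcal D(Q)$, where $\mathcal D(S)$ denotes the set of probability distributions on a finite set $S$. A strategy $\alpha$ assigns to every finite path $\rho=q_0a_0q_1\dots a_{n-1}q_n$ (with $\delta(q_i,a_i)(q_{i+1})>0$ for all $i<n$) a distribution $\alpha(\rho)\in\mathcal D(\mathsf A)$. Given an initial distribution $d_0\in\mathcal D(Q)$ and a strategy $\alpha$, let $\mathcal M^{\alpha}_k\in\mathcal D(Q)$ be the distribution of the state after $k$ steps when the initial state is drawn from $d_0$ and actions are chosen according to $\alpha$. For $T\subseteq Q$ and $d\in\mathcal D(Q)$ let $\mathit{sum}_T(d)=\sum_{q\in T}d(q)$. Define the sets of initial distributions that are, respectively, limit-sure and almost-sure winning for weakly synchronizing in $T$: - $d_0$ is limit-sure winning if for every $\epsilon>0$ there is a strategy $\alpha$ such that, from $d_0$, $\mathit{sum}_T(\mathcal M^{\alpha}_k)\ge 1-\epsilon$ for infinitely many $k$; - $d_0$ is almost-sure winning if there is a strategy $\alpha$ such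 that, from $d_0$, for every $\epsilon>0$, $\mathit{sum}_T(\mathcal M^{\alpha}_k)\ge 1-\epsilon$ for infinitely many $k$. Theorem. For every MDP $\mathcal M$ and every target set $T\subseteq Q$, the set of limit-sure winning initial distributions equals the set of almost-sure winning initial distributions. -/

import Mathlib

/-- Probability distributions on a finite set `S`: nonnegative real functions with sum `1`. -/
abbrev Distr (S : Type*) [Fintype S] : Type _ := stdSimplex ℝ S

/-- A Markov decision process with finite set of states `Q`, finite set of actions `A`, and
probabilistic transition function `δ`. -/
structure MDP (Q A : Type*) [Fintype Q] where
  δ : Q → A → Distr Q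

namespace MDP

variable {Q A : Type*} [Fintype Q] (M : MDP Q A)

/-- `M.Pref n q` is the type of finite paths `q₀ a₀ q₁ a₁ … qₙ` of length `n` with last state
`qₙ = q`, where every `qᵢ₊₁` lies in the support of `δ(qᵢ, aᵢ)`. -/
inductive Pref : ℕ → Q → Type _
  | start (q : Q) : Pref 0 q
  | step {n : ℕ} {q : Q} (ρ : Pref n q) (a : A) (q' : Q) (h : 0 < (M.δ q a).1 q') :
      Pref (n + 1) q'

variable [Fintype A]

/-- A (randomized, history-dependent) strategy maps every finite path to a distribution over
the actions. -/
abbrev Strategy : Type _ := ∀ {n : ℕ} {q : Q}, M.Pref n q → Distr A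

variable {M}

/-- Probability of a finite path `q₀ a₀ q₁ a₁ … qₙ` from the initial distribution `d₀` under `α`:
`d₀(q₀) · ∏_{j < n} α(q₀ a₀ … qⱼ)(aⱼ) · δ(qⱼ, aⱼ)(qⱼ₊₁)`. -/
def Pref.prob (d₀ : Distr Q) (α : M.Strategy) : {n : ℕ} → {q : Q} → M.Pref n q → ℝ
  | _, _, .start q => d₀.1 q
  | _, _, .step (q := q) ρ a q' _ => ρ.prob d₀ α * ((α ρ).1 a * (M.δ q a).1 q')

/-- A finite path of length `n + 1` amounts to a finite path of length `n` together with an action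
and a possible successor state. -/
def Pref.succEquiv (n : ℕ) (q' : Q) :
    M.Pref (n + 1) q' ≃
      Σ q : Q, Σ a : A, {_ρ : M.Pref n q // 0 < (M.δ q a).1 q'} where
  toFun | .step (q := q) ρ a _ h => ⟨q, a, ρ, h⟩
  invFun x := .step x.2.2.1 x.2.1 q' x.2.2.2
  left_inv := by rintro ⟨⟩; rfl
  right_inv := by rintro ⟨q, a, ρ, h⟩; rfl

instance Pref.instFinite (n : ℕ) (q : Q) : Finite (M.Pref n q) := by
  induction n generalizing q with
  | zero =>
    have : Subsingleton (M.Pref 0 q) := ⟨by rintro ⟨⟩ ⟨⟩; rfl⟩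
    infer_instance
  | succ n ih => exact Finite.of_equiv _ (Pref.succEquiv n q).symm

noncomputable instance Pref.instFintype (n : ℕ) (q : Q) : Fintype (M.Pref n q) :=
  Fintype.ofFinite _

/-- The probability of being in state `q` after exactly `k` steps: this event is the disjoint
union of the cylinders of the (finitely many) finite paths of length `k` ending in `q`. -/
noncomputable def stepProb (d₀ : Distr Q) (α : M.Strategy) (k : ℕ) (q : Q) : ℝ :=
  ∑ ρ : M.Pref k q, ρ.prob d₀ α

theorem Pref.prob_nonneg (d₀ : Distr Q) (α : M.Strategy) {n : ℕ} {q : Q} (ρ : M.Pref n q) :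
    0 ≤ ρ.prob d₀ α := by
  induction ρ with
  | start q => exact d₀.2.1 q
  | step ρ a q' h ih => exact mul_nonneg ih (mul_nonneg ((α ρ).2.1 a) ((M.δ _ a).2.1 q'))

theorem stepProb_zero (d₀ : Distr Q) (α : M.Strategy) (q : Q) :
    stepProb d₀ α 0 q = d₀.1 q := by
  have : ∀ ρ : M.Pref 0 q, ρ = .start q := by rintro ⟨⟩; rfl
  rw [stepProb, Fintype.sum_eq_single (.start q) fun ρ h => absurd (this ρ) h]
  rfl

theorem stepProb_succ (d₀ : Distr Q) (α : M.Strategy) (k : ℕ) (q' : Q) :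
    stepProb d₀ α (k + 1) q' =
      ∑ q : Q, ∑ ρ : M.Pref k q, ∑ a : A, ρ.prob d₀ α * ((α ρ).1 a * (M.δ q a).1 q') := by
  classical
  rw [stepProb, ← (Pref.succEquiv k q').symm.sum_comp, Fintype.sum_sigma]
  refine Finset.sum_congr rfl fun q _ => ?_
  rw [Fintype.sum_sigma, Finset.sum_comm]
  refine Finset.sum_congr rfl fun a _ => ?_
  by_cases h : 0 < (M.δ q a).1 q'
  · exact Fintype.sum_equiv (Equiv.subtypeUnivEquiv fun _ => h) _ _ fun _ => rfl
  · have h0 : (M.δ q a).1 q' = 0 := le_antisymm (not_lt.1 h) ((M.δ q a).2.1 q')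
    have : IsEmpty {_ρ : M.Pref k q // 0 < (M.δ q a).1 q'} := ⟨fun x => h x.2⟩
    simp [h0]

theorem stepProb_mem (d₀ : Distr Q) (α : M.Strategy) (k : ℕ) :
    stepProb d₀ α k ∈ stdSimplex ℝ Q := by
  refine ⟨fun q => Finset.sum_nonneg fun ρ _ => ρ.prob_nonneg d₀ α, ?_⟩
  induction k with
  | zero => simp only [stepProb_zero]; exact d₀.2.2
  | succ k ih =>
    rw [← ih]
    simp only [stepProb_succ]
    rw [Finset.sum_comm]
    refine Finset.sum_congr rfl fun q _ => ?_
    rw [Finset.sum_comm, stepProb]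
    refine Finset.sum_congr rfl fun ρ _ => ?_
    rw [Finset.sum_comm]
    simp only [← Finset.mul_sum]
    have h1 (a : A) : ∑ i, (M.δ q a).1 i = 1 := (M.δ q a).2.2
    have h2 : ∑ a, (α ρ).1 a = 1 := (α ρ).2.2
    simp only [h1, mul_one, h2]

/-- The symbolic outcome of `M` from `d₀` under `α`: the sequence of distributions over states
after `0, 1, 2, …` steps. -/
noncomputable def outcome (d₀ : Distr Q) (α : M.Strategy) (k : ℕ) : Distr Q :=
  ⟨stepProb d₀ α k, stepProb_mem d₀ α k⟩

/-- The function `sum_T` on distributions. -/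
def sumOn (T : Finset Q) (d : Distr Q) : ℝ := ∑ q ∈ T, d.1 q

/-- A sequence of distributions is weakly `p`-synchronizing according to `f` if infinitely many
of its members are `p`-synchronized. -/
def WeaklySynchronizing (f : Distr Q → ℝ) (p : ℝ) (d : ℕ → Distr Q) : Prop :=
  {i : ℕ | p ≤ f (d i)}.Infinite

variable (M)

/-- Initial distributions from which some strategy is weakly `(1 - ε)`-synchronizing for all
`ε > 0`. -/
def almostSureWeakly (f : Distr Q → ℝ) : Set (Distr Q) :=
  {d₀ | ∃ α : M.Strategy, ∀ ε : ℝ, 0 < ε → WeaklySynchronizing f (1 - ε) (outcome d₀ α)}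

/-- Initial distributions from which, for all `ε > 0`, some strategy is weakly
`(1 - ε)`-synchronizing. -/
def limitSureWeakly (f : Distr Q → ℝ) : Set (Distr Q) :=
  {d₀ | ∀ ε : ℝ, 0 < ε → ∃ α : M.Strategy, WeaklySynchronizing f (1 - ε) (outcome d₀ α)}

end MDP

/-! Compactness gives one distribution `d` carried by `T` that suitable strategies, depending on the
accuracy, approach infinitely often. Let `f` be the indicator of the complement of the support of
`d`. Then `M.minExp^[n] f q` is the least probability of missing that support after `n` steps from
`q`. Two successive visits near `d` show that from its support one can return to it with arbitrarily
small error. The difficulty is to use a single strategy for all errors, never entering a state from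
which the error can no longer be made small.

The zero set of each iterate determines that of the next, so these finite sets are eventually
periodic, with some period `r`. As `f` takes values in [0, 1], lengthening a large horizon by
multiples of `r` costs at most a constant factor (`exists_minExp_iterate_add_le`). Hence smallness
somewhere along a residue class mod `r` persists, which makes the vanishing states robust. A
modified optimal policy keeps every reachable state vanishing, at the price of another constant
factor (`exists_policy`). Running it over blocks whose lengths are growing multiples of `r` sends
the error to 0 (`mem_almostSureWeakly_of_vanishing`). -/

open Filter Topology

namespace MDP

variable {Q A : Type*} [Fintype Q] (M : MDP Q A)

/-- The least expected value of `f` after one step from the state `q`. -/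
noncomputable def minExp (f : Q → ℝ) (q : Q) : ℝ := ⨅ a, ∑ q', (M.δ q a).1 q' * f q'

/-- States from which the least expectation of `f` with horizon `h + n * r` vanishes as `n` grows. -/
def vanishing (f : Q → ℝ) (r h : ℕ) : Set Q :=
  {q | Tendsto (fun n => M.minExp^[h + n * r] f q) atTop (𝓝 0)}

variable {M} {f g : Q → ℝ}

theorem sum_mul_le_of_forall_le (d : Distr Q) {x : ℝ} (h : ∀ q, d.1 q ≠ 0 → f q ≤ x) :
    ∑ q, d.1 q * f q ≤ x := by
  calc ∑ q, d.1 q * f q ≤ ∑ q, d.1 q * x := by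
        refine Finset.sum_le_sum fun q _ => ?_
        by_cases hq : d.1 q = 0
        · simp [hq]
        · exact mul_le_mul_of_nonneg_left (h q hq) (d.2.1 q)
    _ = x := by rw [← Finset.sum_mul, d.2.2, one_mul]

theorem mul_le_sum_mul (d : Distr Q) (hf : ∀ q, 0 ≤ f q) (q : Q) :
    d.1 q * f q ≤ ∑ q, d.1 q * f q :=
  Finset.single_le_sum (f := fun q => d.1 q * f q)
    (fun q _ => mul_nonneg (d.2.1 q) (hf q)) (Finset.mem_univ q)

theorem mem_vanishing_iff {r h : ℕ} {q : Q} :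
    q ∈ M.vanishing f r h ↔ Tendsto (fun n => M.minExp^[h + n * r] f q) atTop (𝓝 0) := Iff.rfl

theorem vanishing_add_mul (f : Q → ℝ) (r h n : ℕ) :
    M.vanishing f r (h + n * r) = M.vanishing f r h := by
  ext q
  rw [mem_vanishing_iff, mem_vanishing_iff,
    ← tendsto_add_atTop_iff_nat (f := fun m => M.minExp^[h + m * r] f q) n]
  simp only [add_mul, add_assoc, add_comm]

variable [Fintype A]

/-! ### Dynamic programming bounds and Markov strategies -/

theorem minExp_le (f : Q → ℝ) (q : Q) (a : A) :
    M.minExp f q ≤ ∑ q', (M.δ q a).1 q' * f q' :=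
  ciInf_le (Set.finite_range _).bddBelow a

theorem sum_outcome_succ (d₀ : Distr Q) (α : M.Strategy) (k : ℕ) (f : Q → ℝ) :
    ∑ q, (outcome d₀ α (k + 1)).1 q * f q = ∑ q, ∑ ρ : M.Pref k q, ∑ a, ρ.prob d₀ α *
      ((α ρ).1 a * ∑ q', (M.δ q a).1 q' * f q') := by
  simp only [outcome, stepProb_succ, Finset.sum_mul, Finset.mul_sum]
  rw [Finset.sum_comm]
  refine Finset.sum_congr rfl fun q _ => ?_
  rw [Finset.sum_comm]
  refine Finset.sum_congr rfl fun ρ _ => ?_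
  rw [Finset.sum_comm]
  exact Finset.sum_congr rfl fun a _ => Finset.sum_congr rfl fun q' _ => by ring

theorem sum_outcome_mul_minExp_le (d₀ : Distr Q) (α : M.Strategy) (k : ℕ) (f : Q → ℝ) :
    ∑ q, (outcome d₀ α k).1 q * M.minExp f q ≤ ∑ q, (outcome d₀ α (k + 1)).1 q * f q := by
  rw [sum_outcome_succ]
  refine Finset.sum_le_sum fun q _ => ?_
  simp only [outcome, stepProb, Finset.sum_mul]
  refine Finset.sum_le_sum fun ρ _ => ?_
  rw [← Finset.mul_sum]
  refine mul_le_mul_of_nonneg_left ?_ (ρ.prob_nonneg d₀ α)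
  calc M.minExp f q = ∑ a, (α ρ).1 a * M.minExp f q := by
        rw [← Finset.sum_mul, (α ρ).2.2, one_mul]
    _ ≤ _ := Finset.sum_le_sum fun a _ =>
        mul_le_mul_of_nonneg_left (minExp_le f q a) ((α ρ).2.1 a)

/-- Memory and randomization cannot beat backward induction; this turns facts about arbitrary
strategies into bounds on `minExp`. -/
theorem sum_outcome_mul_minExp_iterate_le (d₀ : Distr Q) (α : M.Strategy) (k n : ℕ)
    (f : Q → ℝ) :
    ∑ q, (outcome d₀ α k).1 q * M.minExp^[n] f q ≤ ∑ q, (outcome d₀ α (k + n)).1 q * f q := by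
  induction n generalizing k with
  | zero => rfl
  | succ n ih =>
    rw [Function.iterate_succ_apply']
    refine (sum_outcome_mul_minExp_le d₀ α k _).trans ?_
    rw [← add_assoc, add_right_comm]
    exact ih (k + 1)

variable (M) in
open Classical in
/-- The strategy that at time `n` in state `q` plays the action `π n q`. -/
noncomputable def markovStrategy (π : ℕ → Q → A) : M.Strategy :=
  fun {n q} _ => ⟨Pi.single (π n q) 1, single_mem_stdSimplex ℝ (π n q)⟩

theorem sum_outcome_markovStrategy_succ (d₀ : Distr Q) (π : ℕ → Q → A) (k : ℕ) (f : Q → ℝ) :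
    ∑ q, (outcome d₀ (M.markovStrategy π) (k + 1)).1 q * f q =
      ∑ q, (outcome d₀ (M.markovStrategy π) k).1 q * ∑ q', (M.δ q (π k q)).1 q' * f q' := by
  classical
  rw [sum_outcome_succ]
  refine Finset.sum_congr rfl fun q _ => ?_
  simp only [outcome, stepProb]
  rw [Finset.sum_mul]
  refine Finset.sum_congr rfl fun ρ _ => ?_
  rw [← Finset.mul_sum, Fintype.sum_eq_single (π k q)]
  · simp [markovStrategy]
  · intro a ha
    simp [markovStrategy, Pi.single_eq_of_ne ha]

theorem exists_of_outcome_markovStrategy_succ_ne_zero {d₀ : Distr Q} {π : ℕ → Q → A} {k : ℕ}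
    {q' : Q} (h : (outcome d₀ (M.markovStrategy π) (k + 1)).1 q' ≠ 0) :
    ∃ q, (outcome d₀ (M.markovStrategy π) k).1 q ≠ 0 ∧ (M.δ q (π k q)).1 q' ≠ 0 := by
  classical
  by_contra! hcon
  have := sum_outcome_markovStrategy_succ (M := M) d₀ π k (fun q => if q = q' then 1 else 0)
  simp only [mul_ite, mul_one, mul_zero, Finset.sum_ite_eq', Finset.mem_univ, if_true] at this
  refine h (this.trans (Finset.sum_eq_zero fun q _ => ?_))
  by_cases hq : (outcome d₀ (M.markovStrategy π) k).1 q = 0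
  · rw [hq, zero_mul]
  · rw [hcon q hq, mul_zero]

/-- If from time `a` on the strategy follows the policy `p` with horizon ending at time `b`, then
the invariant `I` is maintained and the expectation of the potential `φ` does not increase. -/
theorem outcome_markovStrategy_of_invariant {p : ℕ → Q → A} {I : ℕ → Set Q} {φ : ℕ → Q → ℝ}
    (hI : ∀ h, ∀ q ∈ I (h + 1), ∀ q', (M.δ q (p h q)).1 q' ≠ 0 → q' ∈ I h)
    (hφ : ∀ h q, ∑ q', (M.δ q (p h q)).1 q' * φ h q' ≤ φ (h + 1) q)
    (d₀ : Distr Q) {π : ℕ → Q → A} {b : ℕ} (n : ℕ) :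
    ∀ a, a + n = b → (∀ t, a ≤ t → t < b → π t = p (b - t - 1)) →
      (∀ q, (outcome d₀ (M.markovStrategy π) a).1 q ≠ 0 → q ∈ I n) →
      (∀ q, (outcome d₀ (M.markovStrategy π) b).1 q ≠ 0 → q ∈ I 0) ∧
        ∑ q, (outcome d₀ (M.markovStrategy π) b).1 q * φ 0 q ≤
          ∑ q, (outcome d₀ (M.markovStrategy π) a).1 q * φ n q := by
  induction n with
  | zero => rintro a rfl _ h; exact ⟨h, le_rfl⟩
  | succ n ih =>
    intro a hab hπ h
    have hp : π a = p n := by rw [hπ a le_rfl (by omega)]; congr 1; omega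
    obtain ⟨h1, h2⟩ := ih (a + 1) (by omega) (fun t ht => hπ t (by omega)) fun q' hq' => by
      obtain ⟨q, hq, hqq'⟩ := exists_of_outcome_markovStrategy_succ_ne_zero hq'
      exact hI n q (h q hq) q' (hp ▸ hqq')
    refine ⟨h1, h2.trans ?_⟩
    rw [sum_outcome_markovStrategy_succ, hp]
    exact Finset.sum_le_sum fun q _ => mul_le_mul_of_nonneg_left (hφ n q)
      ((outcome d₀ (M.markovStrategy π) a).2.1 q)

variable (M) in
theorem almostSureWeakly_subset_limitSureWeakly (f : Distr Q → ℝ) :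
    M.almostSureWeakly f ⊆ M.limitSureWeakly f :=
  fun _ ⟨α, hα⟩ ε hε => ⟨α, hα ε hε⟩

/-! ### A limit distribution by compactness -/

theorem continuous_sumOn (T : Finset Q) : Continuous (sumOn T) :=
  continuous_finsetSum T fun q _ => (continuous_apply q).comp continuous_subtype_val

theorem sumOn_le_one (T : Finset Q) (d : Distr Q) : sumOn T d ≤ 1 :=
  (Finset.sum_le_sum_of_subset_of_nonneg (Finset.subset_univ T) fun q _ _ => d.2.1 q).trans_eq
    d.2.2

/-- Compactness is used twice: each accuracy 1/(n+1) gives a cluster point of one outcome, and `d`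
is a limit of these cluster points. -/
theorem exists_frequently_dist_lt {T : Finset Q} {d₀ : Distr Q}
    (h : d₀ ∈ M.limitSureWeakly (sumOn T)) :
    ∃ d : Distr Q, sumOn T d = 1 ∧
      ∀ η > 0, ∃ α : M.Strategy, ∃ᶠ k in atTop, dist (outcome d₀ α k) d < η := by
  have : CompactSpace (Distr Q) := isCompact_iff_compactSpace.1 (isCompact_stdSimplex ℝ Q)
  have hn : ∀ n : ℕ, ∃ e : Distr Q, 1 - 1 / ((n : ℝ) + 1) ≤ sumOn T e ∧
      ∃ α : M.Strategy, MapClusterPt e atTop (outcome d₀ α) := by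
    intro n
    obtain ⟨α, hα⟩ := h (1 / ((n : ℝ) + 1)) Nat.one_div_pos_of_nat
    have hK : IsCompact {e : Distr Q | 1 - 1 / ((n : ℝ) + 1) ≤ sumOn T e} :=
      (isClosed_le continuous_const (continuous_sumOn T)).isCompact
    obtain ⟨e, he, hcl⟩ := hK.exists_mapClusterPt_of_frequently
      (Nat.frequently_atTop_iff_infinite.2 hα)
    exact ⟨e, he, α, hcl⟩
  choose e he hcl using hn
  obtain ⟨d, ψ, hψ, hd⟩ := CompactSpace.tendsto_subseq e
  refine ⟨d, le_antisymm (sumOn_le_one T d) ?_, fun η hη => ?_⟩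
  · have h1 : Tendsto (fun n => 1 - 1 / ((ψ n : ℝ) + 1)) atTop (𝓝 (1 - 0)) :=
      tendsto_const_nhds.sub
        ((tendsto_one_div_add_atTop_nhds_zero_nat (𝕜 := ℝ)).comp hψ.tendsto_atTop)
    rw [sub_zero] at h1
    exact le_of_tendsto_of_tendsto' h1 (((continuous_sumOn T).tendsto d).comp hd)
      fun n => he (ψ n)
  · obtain ⟨n, hn⟩ := (hd.eventually (Metric.ball_mem_nhds d (half_pos hη))).exists
    obtain ⟨α, hα⟩ := hcl (ψ n)
    refine ⟨α, (hα.frequently (Metric.ball_mem_nhds _ (half_pos hη))).mono fun k hk => ?_⟩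
    have := dist_triangle (outcome d₀ α k) (e (ψ n)) d
    replace hk : dist (outcome d₀ α k) (e (ψ n)) < η / 2 := hk
    have hn' : dist (e (ψ n)) d < η / 2 := hn
    linarith

variable [Nonempty A]

/-! ### Iterated least expectations -/

variable (M) in
theorem exists_minExp_eq (f : Q → ℝ) (q : Q) :
    ∃ a, ∑ q', (M.δ q a).1 q' * f q' = M.minExp f q :=
  exists_eq_ciInf_of_finite

theorem minExp_nonneg (hf : ∀ q, 0 ≤ f q) (q : Q) : 0 ≤ M.minExp f q := by
  obtain ⟨a, ha⟩ := M.exists_minExp_eq f q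
  rw [← ha]
  exact Finset.sum_nonneg fun q' _ => mul_nonneg ((M.δ q a).2.1 q') (hf q')

/-- Play for `f` the action optimal for `g`. Iterated, this serves with `C = 0` for upper bounds,
with `C = 1` for additive errors and with `ε = 0` for constant factors. -/
theorem minExp_le_mul_add {C ε : ℝ} (h : ∀ q, f q ≤ C * g q + ε) (q : Q) :
    M.minExp f q ≤ C * M.minExp g q + ε := by
  obtain ⟨a, ha⟩ := M.exists_minExp_eq g q
  rw [← ha]
  refine (minExp_le f q a).trans ?_
  calc ∑ q', (M.δ q a).1 q' * f q' ≤ ∑ q', (M.δ q a).1 q' * (C * g q' + ε) :=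
        Finset.sum_le_sum fun q' _ => mul_le_mul_of_nonneg_left (h q') ((M.δ q a).2.1 q')
    _ = C * ∑ q', (M.δ q a).1 q' * g q' + (∑ q', (M.δ q a).1 q') * ε := by
        rw [Finset.mul_sum, Finset.sum_mul, ← Finset.sum_add_distrib]
        exact Finset.sum_congr rfl fun _ _ => by ring
    _ = _ := by rw [(M.δ q a).2.2, one_mul]

theorem minExp_iterate_le_mul_add {C ε : ℝ} (h : ∀ q, f q ≤ C * g q + ε) (n : ℕ) (q : Q) :
    M.minExp^[n] f q ≤ C * M.minExp^[n] g q + ε := by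
  induction n generalizing q with
  | zero => exact h q
  | succ n ih =>
    rw [Function.iterate_succ_apply', Function.iterate_succ_apply']
    exact minExp_le_mul_add ih q

theorem minExp_iterate_nonneg (hf : ∀ q, 0 ≤ f q) (n : ℕ) (q : Q) : 0 ≤ M.minExp^[n] f q := by
  induction n generalizing q with
  | zero => exact hf q
  | succ n ih => rw [Function.iterate_succ_apply']; exact minExp_nonneg ih q

theorem minExp_iterate_le_one (hf : ∀ q, f q ≤ 1) (n : ℕ) (q : Q) : M.minExp^[n] f q ≤ 1 := by
  have := minExp_iterate_le_mul_add (M := M) (f := f) (g := f) (C := 0) (ε := 1)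
    (by simpa using hf) n q
  simpa using this

theorem minExp_eq_zero (hg : ∀ q, 0 ≤ g q) (hf : ∀ q, 0 ≤ f q) (h : ∀ q, g q = 0 → f q = 0)
    {q : Q} (hq : M.minExp g q = 0) : M.minExp f q = 0 := by
  obtain ⟨a, ha⟩ := M.exists_minExp_eq g q
  refine le_antisymm ((minExp_le f q a).trans_eq ?_) (minExp_nonneg hf q)
  rw [hq, Finset.sum_eq_zero_iff_of_nonneg
    fun q' _ => mul_nonneg ((M.δ q a).2.1 q') (hg q')] at ha
  refine Finset.sum_eq_zero fun q' hq' => ?_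
  rcases mul_eq_zero.1 (ha q' hq') with h0 | h0
  · rw [h0, zero_mul]
  · rw [h q' h0, mul_zero]

/-- A nonnegative function on a finite type dominates a positive multiple of the indicator of its
support. -/
theorem exists_forall_one_le_mul (f : Q → ℝ) (hf : ∀ q, 0 ≤ f q) :
    ∃ C, 0 < C ∧ ∀ q, f q ≠ 0 → 1 ≤ C * f q := by
  refine ⟨∑ q, (f q)⁻¹ + 1,
    add_pos_of_nonneg_of_pos (Finset.sum_nonneg fun q _ => inv_nonneg.2 (hf q)) one_pos,
    fun q hq => ?_⟩
  have h1 : (f q)⁻¹ ≤ ∑ q, (f q)⁻¹ :=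
    Finset.single_le_sum (f := fun q => (f q)⁻¹) (fun q _ => inv_nonneg.2 (hf q))
      (Finset.mem_univ q)
  calc 1 = (f q)⁻¹ * f q := (inv_mul_cancel₀ hq).symm
    _ ≤ _ := mul_le_mul_of_nonneg_right (by linarith) (hf q)

variable (M) in
/-- The least expectations are monotone along some arithmetic progressions, up to a constant. -/
theorem exists_minExp_iterate_add_le (hf : ∀ q, 0 ≤ f q) (hf1 : ∀ q, f q ≤ 1) :
    ∃ r N : ℕ, ∃ C : ℝ, 0 < r ∧ 0 < C ∧ ∀ m, N ≤ m → ∀ n q,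
      M.minExp^[m + n * r] f q ≤ C * M.minExp^[m] f q := by
  -- Pigeonhole on the finitely many subsets of `Q`. By `minExp_eq_zero` an inclusion between zero
  -- sets propagates to all later horizons.
  obtain ⟨N, N', hlt, hN⟩ : ∃ N N', N < N' ∧
      {q | M.minExp^[N] f q = 0} = {q | M.minExp^[N'] f q = 0} := by
    obtain ⟨x, y, hne, h⟩ :=
      Finite.exists_ne_map_eq_of_infinite fun n => {q | M.minExp^[n] f q = 0}
    rcases lt_or_gt_of_ne hne with h' | h'
    exacts [⟨x, y, h', h⟩, ⟨y, x, h', h.symm⟩]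
  obtain ⟨r, rfl⟩ := Nat.exists_eq_add_of_lt hlt
  have shift : ∀ k q, M.minExp^[N + k] f q = 0 → M.minExp^[N + k + (r + 1)] f q = 0 := by
    intro k
    induction k with
    | zero => intro q hq; exact hN.subset hq
    | succ k ih =>
      intro q hq
      rw [← add_assoc, Function.iterate_succ_apply'] at hq
      rw [show N + (k + 1) + (r + 1) = (N + k + (r + 1)) + 1 by ring,
        Function.iterate_succ_apply']
      exact minExp_eq_zero (minExp_iterate_nonneg hf _) (minExp_iterate_nonneg hf _) ih hq
  have zero : ∀ n q, M.minExp^[N] f q = 0 → M.minExp^[N + n * (r + 1)] f q = 0 := by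
    intro n q hq
    induction n with
    | zero => simpa using hq
    | succ n ih =>
      rw [show N + (n + 1) * (r + 1) = N + n * (r + 1) + (r + 1) by ring]
      exact shift _ _ ih
  obtain ⟨C, hC, hCN⟩ := exists_forall_one_le_mul _ (minExp_iterate_nonneg (M := M) hf N)
  refine ⟨r + 1, N, C, r.succ_pos, hC, fun m hm n q => ?_⟩
  obtain ⟨k, rfl⟩ := Nat.exists_eq_add_of_le hm
  have base : ∀ q, M.minExp^[N + n * (r + 1)] f q ≤ C * M.minExp^[N] f q + 0 := by
    intro q
    rw [add_zero]
    by_cases hq : M.minExp^[N] f q = 0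
    · rw [zero n q hq, hq, mul_zero]
    · exact (minExp_iterate_le_one hf1 _ _).trans (hCN q hq)
  have := minExp_iterate_le_mul_add (M := M) base k q
  rw [← Function.iterate_add_apply, ← Function.iterate_add_apply, add_zero] at this
  rwa [show N + k + n * (r + 1) = k + (N + n * (r + 1)) by ring, add_comm N k]

/-! ### Vanishing states -/

section Vanishing

variable {r N : ℕ} {C : ℝ}

/-- One small value at a horizon beyond `N` bounds all later values in its residue class, up to the
factor `C`. -/
theorem mem_vanishing_of_forall_exists_le (hf : ∀ q, 0 ≤ f q) (hC : 0 < C)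
    (hrN : ∀ m, N ≤ m → ∀ n q, M.minExp^[m + n * r] f q ≤ C * M.minExp^[m] f q) {h : ℕ} {q : Q}
    (hq : ∀ ε > 0, ∃ n, N ≤ h + n * r ∧ M.minExp^[h + n * r] f q ≤ ε) :
    q ∈ M.vanishing f r h := by
  rw [mem_vanishing_iff, Metric.tendsto_atTop]
  intro ε hε
  obtain ⟨n, hn, hle⟩ := hq (ε / 2 / C) (by positivity)
  refine ⟨n, fun m hm => ?_⟩
  obtain ⟨k, rfl⟩ := Nat.exists_eq_add_of_le hm
  rw [Real.dist_0_eq_abs, abs_of_nonneg (minExp_iterate_nonneg hf _ _), add_mul, ← add_assoc]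
  calc _ ≤ C * M.minExp^[h + n * r] f q := hrN _ hn k q
    _ ≤ C * (ε / 2 / C) := by gcongr
    _ = ε / 2 := by field_simp
    _ < ε := half_lt_self hε

/-- With a large horizon, optimal actions preserve vanishing. -/
theorem exists_forall_mem_vanishing (hf : ∀ q, 0 ≤ f q) (hr : 0 < r) (hC : 0 < C)
    (hrN : ∀ m, N ≤ m → ∀ n q, M.minExp^[m + n * r] f q ≤ C * M.minExp^[m] f q)
    (opt : ℕ → Q → A) (hopt : ∀ h q, ∑ q', (M.δ q (opt h q)).1 q' * M.minExp^[h] f q' =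
      M.minExp^[h + 1] f q) :
    ∃ L, ∀ h, L ≤ h → ∀ q ∈ M.vanishing f r (h + 1), ∀ q', (M.δ q (opt h q)).1 q' ≠ 0 →
      q' ∈ M.vanishing f r h := by
  have key : ∀ (i : Fin r) (q : Q) (a : A) (q' : Q), ∀ᶠ n : ℕ in atTop,
      q ∈ M.vanishing f r (i + 1) → opt (i + n * r) q = a → (M.δ q a).1 q' ≠ 0 →
      q' ∈ M.vanishing f r i := by
    intro i q a q'
    by_cases hq' : q' ∈ M.vanishing f r i
    · exact Eventually.of_forall fun _ _ _ _ => hq'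
    by_cases hq : q ∈ M.vanishing f r (i + 1)
    swap
    · exact Eventually.of_forall fun _ h => absurd h hq
    by_cases ha : (M.δ q a).1 q' = 0
    · exact Eventually.of_forall fun _ _ _ h => absurd ha h
    have hpos : 0 < (M.δ q a).1 q' := lt_of_le_of_ne ((M.δ q a).2.1 q') (Ne.symm ha)
    -- A non-vanishing successor costs at least its transition probability times a fixed `ε`, which
    -- for large `n` exceeds the optimal value at the vanishing state `q`.
    obtain ⟨ε, hε, hlt⟩ : ∃ ε > 0, ∀ n, N ≤ i + n * r → ε < M.minExp^[i + n * r] f q' := by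
      by_contra! hcon
      exact hq' (mem_vanishing_of_forall_exists_le hf hC hrN hcon)
    have hev := (mem_vanishing_iff.1 hq).eventually (gt_mem_nhds (mul_pos hpos hε))
    filter_upwards [hev, eventually_ge_atTop N] with n hn hnN _ hopt_eq _
    exfalso
    have h1 := hopt (i + n * r) q
    rw [hopt_eq] at h1
    have h2 := mul_le_sum_mul (M.δ q a) (minExp_iterate_nonneg (M := M) hf (i + n * r)) q'
    rw [h1] at h2
    have h3 := hlt n (by nlinarith)
    rw [show (i : ℕ) + 1 + n * r = i + n * r + 1 by ring] at hn
    exact absurd (mul_lt_mul_of_pos_left h3 hpos) (not_lt.2 (h2.trans hn.le))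
  simp only [← eventually_all] at key
  obtain ⟨L, hL⟩ := eventually_atTop.1 key
  refine ⟨L * r, fun h hh q hq q' hq' => ?_⟩
  have e : h % r + h / r * r = h := by rw [mul_comm]; exact Nat.mod_add_div h r
  have hdiv : L ≤ h / r := (Nat.le_div_iff_mul_le hr).2 hh
  have := hL (h / r) hdiv ⟨h % r, Nat.mod_lt h hr⟩ q (opt h q) q'
  rw [Fin.val_mk, e] at this
  rw [← e, vanishing_add_mul]
  refine this ?_ rfl hq'
  rwa [← e, add_right_comm, vanishing_add_mul] at hq

end Vanishing

/-! ### A single almost-sure strategy -/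

section Vanishing

variable {r N : ℕ} {C : ℝ}

/-- A policy, indexed by the remaining horizon, which keeps vanishing states vanishing and for large
horizons achieves the least expectation of `f` up to a constant. -/
theorem exists_policy (hf : ∀ q, 0 ≤ f q) (hf1 : ∀ q, f q ≤ 1) (hr : 0 < r) (hC : 0 < C)
    (hrN : ∀ m, N ≤ m → ∀ n q, M.minExp^[m + n * r] f q ≤ C * M.minExp^[m] f q) :
    ∃ (L : ℕ) (K : ℝ) (p : ℕ → Q → A) (I : ℕ → Set Q) (φ : ℕ → Q → ℝ), 0 < K ∧
      (∀ h, ∀ q ∈ I (h + 1), ∀ q', (M.δ q (p h q)).1 q' ≠ 0 → q' ∈ I h) ∧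
      (∀ h q, ∑ q', (M.δ q (p h q)).1 q' * φ h q' ≤ φ (h + 1) q) ∧
      (∀ q ∈ I 0, q ∈ M.vanishing f r 0 ∨ f q = 0) ∧ (∀ q, f q ≤ φ 0 q) ∧
      ∀ h, L ≤ h → I h = M.vanishing f r h ∧ ∀ q, φ h q = K * M.minExp^[h] f q := by
  classical
  choose opt hopt using fun h q => M.exists_minExp_eq (M.minExp^[h] f) q
  replace hopt : ∀ h q, ∑ q', (M.δ q (opt h q)).1 q' * M.minExp^[h] f q' =
      M.minExp^[h + 1] f q := fun h q => by
    rw [Function.iterate_succ_apply']; exact hopt h q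
  obtain ⟨L₀, hL₀⟩ := exists_forall_mem_vanishing hf hr hC hrN opt hopt
  obtain ⟨L, hL1, hL⟩ : ∃ L, 1 ≤ L ∧ L₀ ≤ L := ⟨L₀ + 1, by omega, by omega⟩
  obtain ⟨K, hK, hKL⟩ := exists_forall_one_le_mul _ (minExp_iterate_nonneg (M := M) hf L)
  have hzero : ∀ {h q q'}, M.minExp^[h + 1] f q = 0 → (M.δ q (opt h q)).1 q' ≠ 0 →
      M.minExp^[h] f q' = 0 := by
    intro h q q' hq hq'
    have h1 := mul_le_sum_mul (M.δ q (opt h q)) (minExp_iterate_nonneg (M := M) hf h) q'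
    rw [hopt, hq] at h1
    have h2 := lt_of_le_of_ne ((M.δ q (opt h q)).2.1 q') hq'.symm
    exact le_antisymm (nonpos_of_mul_nonpos_right h1 h2) (minExp_iterate_nonneg hf _ _)
  -- Below horizon `L`, optimal play may leave the vanishing states. It is kept only where the value
  -- is 0. Elsewhere the target is given up and the action for a horizon longer by `L * r` preserves
  -- vanishing. The potential charges 1 for giving up; `K` makes this affordable on passing from
  -- horizon `L` to `L - 1`.
  refine ⟨L, K, fun h q => if L ≤ h ∨ M.minExp^[h + 1] f q = 0 then opt h q
      else opt (h + L * r) q,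
    fun h => {q | q ∈ M.vanishing f r h ∨ h < L ∧ M.minExp^[h] f q = 0},
    fun h q => if L ≤ h then K * M.minExp^[h] f q else if M.minExp^[h] f q = 0 then 0 else 1,
    hK, ?_, ?_, ?_, ?_, ?_⟩
  · intro h q hq q' hq'
    beta_reduce at hq hq' ⊢
    by_cases hLh : L ≤ h
    · rw [if_pos (Or.inl hLh)] at hq'
      exact Or.inl (hL₀ h (hL.trans hLh) q (hq.resolve_right fun h' => by omega) q' hq')
    by_cases h0 : M.minExp^[h + 1] f q = 0
    · rw [if_pos (Or.inr h0)] at hq'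
      exact Or.inr ⟨not_le.1 hLh, hzero h0 hq'⟩
    · rw [if_neg (not_or.2 ⟨hLh, h0⟩)] at hq'
      have h1 := hq.resolve_right fun h' => h0 h'.2
      rw [← vanishing_add_mul f r _ L, add_right_comm] at h1
      have h2 := hL₀ (h + L * r) (by nlinarith) q h1 q' hq'
      rw [vanishing_add_mul] at h2
      exact Or.inl h2
  · intro h q
    by_cases hLh : L ≤ h
    · simp only [hLh, true_or, if_true, hLh.trans h.le_succ]
      rw [← hopt, Finset.mul_sum]
      exact (Finset.sum_congr rfl fun _ _ => by ring).le
    simp only [hLh, false_or, if_false]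
    by_cases h0 : M.minExp^[h + 1] f q = 0
    · simp only [h0, if_true, mul_zero, ite_self]
      refine sum_mul_le_of_forall_le _ fun q' hq' => ?_
      rw [if_pos (hzero h0 hq')]
    · simp only [h0, if_false]
      refine (sum_mul_le_of_forall_le (x := 1) _ fun q' _ => ?_).trans ?_
      · split_ifs <;> norm_num
      · split_ifs with h1
        · obtain rfl : h + 1 = L := by omega
          exact hKL q h0
        · exact le_rfl
  · rintro q (hq | hq)
    exacts [Or.inl hq, Or.inr hq.2]
  · intro q
    beta_reduce
    rw [if_neg (by omega)]
    split_ifs with h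
    exacts [h.le, hf1 q]
  · intro h hh
    refine ⟨?_, fun q => if_pos hh⟩
    ext q
    simp [not_lt.2 hh]

/-- By `h₀`, zeros of `f` are again vanishing for residue 0, so every state reached at the end of a
block, whether or not it hits the target, can start the next one. -/
theorem mem_almostSureWeakly_of_vanishing (hf : ∀ q, 0 ≤ f q) (hf1 : ∀ q, f q ≤ 1) (hr : 0 < r)
    (hC : 0 < C) (hrN : ∀ m, N ≤ m → ∀ n q, M.minExp^[m + n * r] f q ≤ C * M.minExp^[m] f q)
    {T : Finset Q} (hT : ∀ q ∉ T, 1 ≤ f q) (h₀ : ∀ q, f q = 0 → q ∈ M.vanishing f r 0)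
    {d₀ : Distr Q} {i : ℕ} (hi : ∀ q, d₀.1 q ≠ 0 → q ∈ M.vanishing f r i) :
    d₀ ∈ M.almostSureWeakly (sumOn T) := by
  classical
  obtain ⟨L, K, p, I, φ, hK, hI, hφ, hI0, hφ0, hL⟩ := exists_policy hf hf1 hr hC hrN
  replace hI0 : ∀ q ∈ I 0, q ∈ M.vanishing f r 0 := fun q hq => (hI0 q hq).elim id (h₀ q)
  -- Block ends: the first block has residue `i`, every later one has length `(L + 1) * 2 ^ j * r`,
  -- a multiple of `r` that is at least `L`.
  set b : ℕ → ℕ := fun j => i + (L + 1) * 2 ^ j * r with hb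
  have hbmono : StrictMono b := strictMono_nat_of_lt_succ fun j => by
    have : 0 < 2 ^ j * r := by positivity
    simp only [hb, pow_succ]
    nlinarith
  have hex : ∀ t, ∃ j, t < b j := fun t => ⟨t + 1, hbmono.le_apply⟩
  set π : ℕ → Q → A := fun t => p (b (Nat.find (hex t)) - t - 1) with hπ
  have hπ0 : ∀ t, 0 ≤ t → t < b 0 → π t = p (b 0 - t - 1) := by
    intro t _ ht
    rw [hπ]
    simp only [(Nat.find_eq_zero (hex t)).2 ht]
  have hπs : ∀ j t, b j ≤ t → t < b (j + 1) → π t = p (b (j + 1) - t - 1) := by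
    intro j t hjt ht
    have : Nat.find (hex t) = j + 1 := (Nat.find_eq_iff _).2 ⟨ht, fun n hn =>
      not_lt.2 ((hbmono.monotone (Nat.lt_succ_iff.1 hn)).trans hjt)⟩
    rw [hπ]
    simp only [this]
  have hgap : ∀ j, b j + (0 + (L + 1) * 2 ^ j * r) = b (j + 1) := fun j => by
    simp only [hb, pow_succ]; ring
  have hge : ∀ j, L ≤ (L + 1) * 2 ^ j * r := fun j => by
    have : 0 < 2 ^ j * r := by positivity
    nlinarith
  have hinv : ∀ j q, (outcome d₀ (M.markovStrategy π) (b j)).1 q ≠ 0 →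
      q ∈ M.vanishing f r 0 := by
    intro j
    induction j with
    | zero =>
      intro q hq
      refine hI0 q ((outcome_markovStrategy_of_invariant hI hφ d₀ (b 0) 0 (zero_add _) hπ0
        fun q hq => ?_).1 q hq)
      rw [(hL (b 0) ((hge 0).trans (Nat.le_add_left _ _))).1, hb, vanishing_add_mul]
      exact hi q (by simpa [outcome, stepProb_zero] using hq)
    | succ j ih =>
      intro q hq
      refine hI0 q ((outcome_markovStrategy_of_invariant hI hφ d₀ _ (b j) (hgap j) (hπs j)
        fun q hq => ?_).1 q hq)
      rw [(hL _ (by simpa using hge j)).1, vanishing_add_mul]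
      exact ih q hq
  refine ⟨M.markovStrategy π, fun ε hε => Nat.frequently_atTop_iff_infinite.1 ?_⟩
  have hev : ∀ᶠ n : ℕ in atTop, ∀ q, q ∈ M.vanishing f r 0 →
      M.minExp^[0 + n * r] f q < ε / K := by
    refine eventually_all.2 fun q => ?_
    by_cases hq : q ∈ M.vanishing f r 0
    · filter_upwards [(mem_vanishing_iff.1 hq).eventually (gt_mem_nhds (div_pos hε hK))] with n hn _
      exact hn
    · exact Eventually.of_forall fun n h => absurd h hq
  have hlim : Tendsto (fun j => (L + 1) * 2 ^ j) atTop atTop :=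
    (tendsto_pow_atTop_atTop_of_one_lt one_lt_two).const_mul_atTop' L.succ_pos
  refine (hbmono.comp (strictMono_id.add_const 1)).tendsto_atTop.frequently
    ((hlim.eventually hev).mono fun j hj => ?_).frequently
  have hle := (outcome_markovStrategy_of_invariant hI hφ d₀ _ (b j) (hgap j) (hπs j) fun q hq => by
    rw [(hL _ (by simpa using hge j)).1, vanishing_add_mul]
    exact hinv j q hq).2
  have hle2 := hle.trans (sum_mul_le_of_forall_le (x := ε) _ fun q hq => by
    rw [(hL _ (by simpa using hge j)).2]
    exact ((lt_div_iff₀' hK).1 (hj q (hinv j q hq))).le)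
  set D := outcome d₀ (M.markovStrategy π) (b (j + 1)) with hD
  have hsum : ∑ q ∈ T, D.1 q + ∑ q ∈ Tᶜ, D.1 q = 1 := by
    rw [Finset.sum_add_sum_compl, D.2.2]
  have hout : ∑ q ∈ Tᶜ, D.1 q ≤ ∑ q, D.1 q * φ 0 q := by
    calc ∑ q ∈ Tᶜ, D.1 q ≤ ∑ q ∈ Tᶜ, D.1 q * φ 0 q :=
          Finset.sum_le_sum fun q hq => le_mul_of_one_le_right (D.2.1 q)
            ((hT q (Finset.mem_compl.1 hq)).trans (hφ0 q))
      _ ≤ _ := Finset.sum_le_sum_of_subset_of_nonneg (Finset.subset_univ _) fun q _ _ =>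
          mul_nonneg (D.2.1 q) ((hf q).trans (hφ0 q))
  change 1 - ε ≤ ∑ q ∈ T, D.1 q
  linarith

/-- If the least expectations of `f` exceed `f` by an arbitrarily small amount after some positive
number of steps, then this number can be chosen as a large multiple of `r`. -/
theorem exists_minExp_iterate_mul_le_add (hr : 0 < r)
    (hk : ∀ ε > 0, ∃ k, 0 < k ∧ ∀ q, M.minExp^[k] f q ≤ f q + ε) {ε : ℝ} (hε : 0 < ε) (N : ℕ) :
    ∃ k, N ≤ k * r ∧ ∀ q, M.minExp^[k * r] f q ≤ f q + ε := by
  -- The `k`-step bound is iterated `(N + 1) * r` times, so the errors add up to `ε`.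
  obtain ⟨k, hk0, hk⟩ := hk (ε / (((N + 1) * r : ℕ) : ℝ)) (by positivity)
  have iter : ∀ m : ℕ, ∀ q, M.minExp^[m * k] f q ≤ f q + m * (ε / (((N + 1) * r : ℕ) : ℝ)) := by
    intro m
    induction m with
    | zero => simp
    | succ m ih =>
      intro q
      have := minExp_iterate_le_mul_add (M := M) (f := M.minExp^[k] f) (g := f) (C := 1)
        (by simpa using hk) (m * k) q
      rw [← Function.iterate_add_apply, ← Nat.succ_mul, one_mul] at this
      push_cast at this ih ⊢
      linarith [ih q]
  refine ⟨(N + 1) * k, ?_, fun q => ?_⟩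
  · calc N ≤ (N + 1) * 1 * 1 := by omega
      _ ≤ (N + 1) * k * r := by gcongr <;> omega
  · have := iter ((N + 1) * r) q
    rwa [mul_div_cancel₀ _ (by positivity), mul_right_comm] at this

theorem exists_forall_mem_vanishing_of_exists_le (hf : ∀ q, 0 ≤ f q) (hr : 0 < r) (hC : 0 < C)
    (hrN : ∀ m, N ≤ m → ∀ n q, M.minExp^[m + n * r] f q ≤ C * M.minExp^[m] f q)
    (hk : ∀ ε > 0, ∃ k, 0 < k ∧ ∀ q, M.minExp^[k] f q ≤ f q + ε) {S : Set Q}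
    (hS : ∀ ε > 0, ∃ n, ∀ q ∈ S, M.minExp^[n] f q ≤ ε) :
    ∃ i, ∀ q ∈ S, q ∈ M.vanishing f r i := by
  by_contra! hcon
  choose s hsS hs using hcon
  have hbound : ∀ i, ∃ ε > 0, ∀ n, N ≤ i + n * r → ε < M.minExp^[i + n * r] f (s i) := by
    intro i
    by_contra! h
    exact hs i (mem_vanishing_of_forall_exists_le hf hC hrN h)
  choose ε hε hlt using hbound
  have : Nonempty (Fin r) := ⟨⟨0, hr⟩⟩
  obtain ⟨i₀, hi₀⟩ := Finite.exists_min fun i : Fin r => ε i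
  -- Half of the least of the `r` bounds pays for reaching small `f` in `n` steps, the other half
  -- for `k * r` further steps that push the horizon beyond `N` without changing its residue.
  obtain ⟨n, hn⟩ := hS (ε i₀ / 2) (half_pos (hε _))
  obtain ⟨k, hkN, hk⟩ := exists_minExp_iterate_mul_le_add hr hk (half_pos (hε i₀)) N
  have e : n % r + (n / r + k) * r = n + k * r := by
    rw [add_mul, ← add_assoc, mul_comm (n / r), Nat.mod_add_div]
  have h1 := hlt (n % r) (n / r + k) (by omega)
  have h2 := minExp_iterate_le_mul_add (M := M) (f := M.minExp^[k * r] f) (g := f) (C := 1)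
    (by simpa using hk) n (s (n % r))
  rw [← Function.iterate_add_apply] at h2
  rw [e] at h1
  have h3 := hn _ (hsS (n % r))
  have h4 := hi₀ ⟨n % r, Nat.mod_lt n hr⟩
  simp only at h4
  linarith

end Vanishing

/-! ### Conclusion -/

theorem limitSureWeakly_subset_almostSureWeakly (T : Finset Q) :
    M.limitSureWeakly (sumOn T) ⊆ M.almostSureWeakly (sumOn T) := by
  classical
  intro d₀ h₀
  obtain ⟨d, hdT, hd⟩ := exists_frequently_dist_lt h₀
  set f : Q → ℝ := fun q => if d.1 q = 0 then 1 else 0 with hfdef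
  have hf : ∀ q, 0 ≤ f q := fun q => by simp only [hfdef]; split_ifs <;> norm_num
  have hf1 : ∀ q, f q ≤ 1 := fun q => by simp only [hfdef]; split_ifs <;> norm_num
  have hfd : ∀ q, f q = 0 → d.1 q ≠ 0 := fun q hq h => by simp [hfdef, h] at hq
  have hfd' : ∀ q, d.1 q = 0 → f q = 1 := fun q hq => by simp [hfdef, hq]
  have hT : ∀ q ∉ T, 1 ≤ f q := by
    intro q hq
    refine (hfd' q ?_).ge
    have hsum : ∑ q ∈ T, d.1 q + ∑ q ∈ Tᶜ, d.1 q = 1 := by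
      rw [Finset.sum_add_sum_compl, d.2.2]
    have h1 : ∑ q ∈ Tᶜ, d.1 q = 0 := by
      have : ∑ q ∈ T, d.1 q = 1 := hdT
      linarith
    exact (Finset.sum_eq_zero_iff_of_nonneg fun q _ => d.2.1 q).1 h1 q (Finset.mem_compl.2 hq)
  have hdist : ∀ (D : Distr Q) q, |D.1 q - d.1 q| ≤ dist D d := fun D q => by
    rw [← Real.dist_eq]; exact dist_le_pi_dist D.1 d.1 q
  have hDf : ∀ (D : Distr Q), ∑ q, D.1 q * f q ≤ Fintype.card Q * dist D d := by
    intro D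
    rw [← nsmul_eq_mul, ← Finset.card_univ]
    refine Finset.sum_le_card_nsmul _ _ _ fun q _ => ?_
    by_cases hq : d.1 q = 0
    · rw [hfd' q hq, mul_one]
      simpa [hq] using (le_abs_self _).trans (hdist D q)
    · rw [hfdef]
      simp [hq]
  have hcard : (0 : ℝ) < Fintype.card Q + 1 := by positivity
  obtain ⟨r, N, C, hr, hC, hrN⟩ := M.exists_minExp_iterate_add_le hf hf1
  have hk : ∀ ε > 0, ∃ k, 0 < k ∧ ∀ q, M.minExp^[k] f q ≤ f q + ε := by
    intro ε hε
    obtain ⟨K, hK, hKd⟩ := exists_forall_one_le_mul d.1 d.2.1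
    -- States of the support of `d` have mass at least `1 / K`, hence at least `1 / (2 * K)` at time
    -- `k₁`. The second bound keeps the mass outside the support at the later visit small enough
    -- after division by this.
    set η := min (1 / (2 * K)) (ε / (2 * K * (Fintype.card Q + 1))) with hη
    have hηpos : 0 < η := by positivity
    obtain ⟨α, hα⟩ := hd η hηpos
    obtain ⟨k₁, hk₁⟩ := hα.exists
    obtain ⟨k₂, hk₂, hlt⟩ := (hα.and_eventually (eventually_gt_atTop k₁)).exists
    obtain ⟨k, rfl⟩ := Nat.exists_eq_add_of_lt hlt
    refine ⟨k + 1, k.succ_pos, fun q => ?_⟩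
    by_cases hq : d.1 q = 0
    · rw [hfd' q hq]
      linarith [minExp_iterate_le_one (M := M) hf1 (k + 1) q]
    have h1 := sum_outcome_mul_minExp_iterate_le d₀ α k₁ (k + 1) f
    have h2 := mul_le_sum_mul (outcome d₀ α k₁)
      (minExp_iterate_nonneg (M := M) hf (k + 1)) q
    have h3 := hDf (outcome d₀ α (k₁ + (k + 1)))
    have h4 : K * η ≤ 1 / 2 := by
      calc K * η ≤ K * (1 / (2 * K)) := by gcongr; exact min_le_left _ _
        _ = 1 / 2 := by field_simp
    have h5 : 2 * K * ((Fintype.card Q + 1) * η) ≤ ε := by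
      calc _ ≤ 2 * K * ((Fintype.card Q + 1) * (ε / (2 * K * (Fintype.card Q + 1)))) := by
            gcongr; exact min_le_right _ _
        _ = ε := by field_simp
    have h6 : 1 / 2 ≤ K * (outcome d₀ α k₁).1 q := by
      have := (abs_le.1 ((hdist (outcome d₀ α k₁) q).trans hk₁.le)).1
      have := mul_le_mul_of_nonneg_left this hK.le
      linarith [hKd q hq]
    have h7 : Fintype.card Q * dist (outcome d₀ α (k₁ + (k + 1))) d ≤
        (Fintype.card Q + 1) * η := by
      gcongr
      · linarith
      · exact hk₂.le
    have h8 := minExp_iterate_nonneg (M := M) hf (k + 1) q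
    calc M.minExp^[k + 1] f q ≤ 2 * (K * (outcome d₀ α k₁).1 q) * M.minExp^[k + 1] f q :=
          le_mul_of_one_le_left h8 (by linarith)
      _ = 2 * K * ((outcome d₀ α k₁).1 q * M.minExp^[k + 1] f q) := by ring
      _ ≤ 2 * K * ((Fintype.card Q + 1) * η) := by
          exact mul_le_mul_of_nonneg_left (h2.trans (h1.trans (h3.trans h7))) (by positivity)
      _ ≤ f q + ε := h5.trans (le_add_of_nonneg_left (hf q))
  have hS : ∀ ε > 0, ∃ n, ∀ q ∈ {q | d₀.1 q ≠ 0}, M.minExp^[n] f q ≤ ε := by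
    intro ε hε
    obtain ⟨K, hK, hKd⟩ := exists_forall_one_le_mul d₀.1 d₀.2.1
    obtain ⟨α, hα⟩ := hd (ε / (K * (Fintype.card Q + 1))) (by positivity)
    obtain ⟨n, hn⟩ := hα.exists
    refine ⟨n, fun q hq => ?_⟩
    have h1 := sum_outcome_mul_minExp_iterate_le d₀ α 0 n f
    rw [zero_add] at h1
    have h2 := mul_le_sum_mul (outcome d₀ α 0) (minExp_iterate_nonneg (M := M) hf n) q
    have h0 : (outcome d₀ α 0).1 q = d₀.1 q := stepProb_zero d₀ α q
    rw [h0] at h2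
    have h3 := hDf (outcome d₀ α n)
    calc M.minExp^[n] f q ≤ K * d₀.1 q * M.minExp^[n] f q :=
          le_mul_of_one_le_left (minExp_iterate_nonneg hf n q) (hKd q hq)
      _ = K * (d₀.1 q * M.minExp^[n] f q) := by ring
      _ ≤ K * ((Fintype.card Q + 1) * (ε / (K * (Fintype.card Q + 1)))) := by
          refine mul_le_mul_of_nonneg_left (h2.trans (h1.trans (h3.trans ?_))) hK.le
          gcongr
          linarith
      _ = ε := by field_simp
  obtain ⟨i, hi⟩ := exists_forall_mem_vanishing_of_exists_le hf hr hC hrN hk hS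
  refine mem_almostSureWeakly_of_vanishing hf hf1 hr hC hrN hT (fun q hq => ?_) hi
  -- From the support of `d`, returns with small error exist at large horizons divisible by `r`.
  refine mem_vanishing_of_forall_exists_le hf hC hrN fun ε hε => ?_
  obtain ⟨k, hkN, hk⟩ := exists_minExp_iterate_mul_le_add hr hk hε N
  refine ⟨k, by simpa using hkN, ?_⟩
  simpa [hq] using hk q

end MDP

/-- For every MDP and every target set `T`, the limit-sure and the almost-sure winning regions for
the weakly synchronizing objective with function `sum_T` coincide. -/
theorem mainTheorem1 {Q A : Type*} [Fintype Q] [Fintype A] (M : MDP Q A) (T : Finset Q) :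
    M.limitSureWeakly (MDP.sumOn T) = M.almostSureWeakly (MDP.sumOn T) := by
  refine Set.Subset.antisymm (fun d₀ h => ?_) (M.almostSureWeakly_subset_limitSureWeakly _)
  obtain ⟨α, -⟩ := h 1 one_pos
  have : Nonempty Q := by
    by_contra hQ
    rw [not_nonempty_iff] at hQ
    simpa using d₀.2.2
  obtain ⟨q⟩ := this
  have : Nonempty A := by
    by_contra hA
    rw [not_nonempty_iff] at hA
    simpa using (α (MDP.Pref.start q)).2.2
  exact MDP.limitSureWeakly_subset_almostSureWeakly T h
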